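/- Let $\Bbbk$ be a field. Let $\mathcal{TL}_0(\Bbbk)$ be the strict $\Bbbk$-linear monoidal category with objects $[0],[1],[2],\ldots$, tensor product $[m]\otimes[n]=[m+n]$ and unit object $\mathbb{1}=[0]$, whose morphisms are generated by $\mathrm{cup}\colon[0]\to[2]$ and $\mathrm{cap}\colon[2]\to[0]$ subject to the relations $$(\mathrm{id}_{[1]}\otimes\mathrm{cap})\circ(\mathrm{cup}\otimes\mathrm{id}_{[1]})=0=(\mathrm{cap}\otimes\mathrm{id}_{[1]})\circ(\mathrm{id}_{[1]}\otimes\mathrm{cup}),\qquad \mathrm{cap}\circ\mathrm{cup}=\mathrm{id}_{[0]};$$ that is, the specialization at $q=0$ of the category defined by the same generators in which both zig-zags equal $q\cdot\mathrm{id}_{[1]}$ and the circle equals $(q^2+1)\,\mathrm{id}_{[0]}$. A right dual of an object $X$ is an object $X^\vee$ with morphisms $\eta\colon\mathbb{1}\to X^\vee\otimes X$ and $\varepsilon\colon X\otimes X^\vee\to\mathbb{1}$ satisfying the two triangle identities; left duals are defined symmetrically, and a monoidal category is rigid if every object has both a left and a right dual. Then the object $[1]$ of $\mathcal{TL}_0(\Bbbk)$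 has no right dual. In particular, $\mathcal{TL}_0(\Bbbk)$ is not rigid. -/

import Mathlib

open CategoryTheory MonoidalCategory

universe u

namespace TemperleyLieb

/-- Formal expressions for the morphisms `[m] ⟶ [n]` of a strict `R`-linear monoidal category whose
monoid of objects is `(ℕ, +, 0)`, generated by `cup : [0] ⟶ [2]` and `cap : [2] ⟶ [0]`.
Composition is written in diagrammatic order. The expression `eqTo h` denotes the identity
of `[m] = [n]`; it is needed because `(a + b) + c = a + (b + c)` and `a + 0 = a`, `0 + a = a` are
not definitional equalities of indices. -/
inductive Term (R : Type u) : ℕ → ℕ → Type u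
  | eqTo {m n : ℕ} (h : m = n) : Term R m n
  | cup : Term R 0 2
  | cap : Term R 2 0
  | comp {l m n : ℕ} (f : Term R l m) (g : Term R m n) : Term R l n
  | tensor {m n m' n' : ℕ} (f : Term R m n) (g : Term R m' n') : Term R (m + m') (n + n')
  | zero {m n : ℕ} : Term R m n
  | add {m n : ℕ} (f g : Term R m n) : Term R m n
  | smul {m n : ℕ} (r : R) (f : Term R m n) : Term R m n

/-- The identity of `[n]`. -/
abbrev Term.id {R : Type u} (n : ℕ) : Term R n n := Term.eqTo rfl

/-- The congruence on formal expressions generated by the axioms of a strict `R`-linear monoidal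
category together with the two zig-zag relations (both zig-zags are `q • id`) and
the circle relation (the circle is `(q ^ 2 + 1) • id`). -/
inductive Rel {R : Type u} [CommRing R] (q : R) :
    ∀ {m n : ℕ}, Term R m n → Term R m n → Prop
  -- congruence
  | refl {m n} (f : Term R m n) : Rel q f f
  | symm {m n} {f g : Term R m n} : Rel q f g → Rel q g f
  | trans {m n} {f g h : Term R m n} : Rel q f g → Rel q g h → Rel q f h
  | comp_congr {l m n} {f f' : Term R l m} {g g' : Term R m n} :
      Rel q f f' → Rel q g g' → Rel q (f.comp g) (f'.comp g')
  | tensor_congr {m n m' n'} {f f' : Term R m n} {g g' : Term R m' n'} :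
      Rel q f f' → Rel q g g' → Rel q (f.tensor g) (f'.tensor g')
  | add_congr {m n} {f f' g g' : Term R m n} :
      Rel q f f' → Rel q g g' → Rel q (f.add g) (f'.add g')
  | smul_congr {m n} (r : R) {f f' : Term R m n} :
      Rel q f f' → Rel q (f.smul r) (f'.smul r)
  -- category
  | id_comp {m n} (f : Term R m n) : Rel q ((Term.id m).comp f) f
  | comp_id {m n} (f : Term R m n) : Rel q (f.comp (Term.id n)) f
  | assoc {k l m n} (f : Term R k l) (g : Term R l m) (h : Term R m n) :
      Rel q ((f.comp g).comp h) (f.comp (g.comp h))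
  -- the hom-sets are `R`-modules
  | add_assoc {m n} (f g h : Term R m n) : Rel q ((f.add g).add h) (f.add (g.add h))
  | add_comm {m n} (f g : Term R m n) : Rel q (f.add g) (g.add f)
  | zero_add {m n} (f : Term R m n) : Rel q (Term.zero.add f) f
  | smul_add {m n} (r : R) (f g : Term R m n) :
      Rel q ((f.add g).smul r) ((f.smul r).add (g.smul r))
  | add_smul {m n} (r s : R) (f : Term R m n) :
      Rel q (f.smul (r + s)) ((f.smul r).add (f.smul s))
  | mul_smul {m n} (r s : R) (f : Term R m n) : Rel q (f.smul (r * s)) ((f.smul s).smul r)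
  | one_smul {m n} (f : Term R m n) : Rel q (f.smul 1) f
  | zero_smul {m n} (f : Term R m n) : Rel q (f.smul 0) Term.zero
  -- composition is bilinear
  | add_comp {l m n} (f f' : Term R l m) (g : Term R m n) :
      Rel q ((f.add f').comp g) ((f.comp g).add (f'.comp g))
  | comp_add {l m n} (f : Term R l m) (g g' : Term R m n) :
      Rel q (f.comp (g.add g')) ((f.comp g).add (f.comp g'))
  | smul_comp {l m n} (r : R) (f : Term R l m) (g : Term R m n) :
      Rel q ((f.smul r).comp g) ((f.comp g).smul r)
  | comp_smul {l m n} (r : R) (f : Term R l m) (g : Term R m n) :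
      Rel q (f.comp (g.smul r)) ((f.comp g).smul r)
  -- the tensor product is bilinear
  | add_tensor {m n m' n'} (f f' : Term R m n) (g : Term R m' n') :
      Rel q ((f.add f').tensor g) ((f.tensor g).add (f'.tensor g))
  | tensor_add {m n m' n'} (f : Term R m n) (g g' : Term R m' n') :
      Rel q (f.tensor (g.add g')) ((f.tensor g).add (f.tensor g'))
  | smul_tensor {m n m' n'} (r : R) (f : Term R m n) (g : Term R m' n') :
      Rel q ((f.smul r).tensor g) ((f.tensor g).smul r)
  | tensor_smul {m n m' n'} (r : R) (f : Term R m n) (g : Term R m' n') :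
      Rel q (f.tensor (g.smul r)) ((f.tensor g).smul r)
  -- the tensor product is a functor, strictly associative and unital
  | id_tensor_id (m n : ℕ) : Rel q ((Term.id m).tensor (Term.id n)) (Term.id (m + n))
  | tensor_comp_tensor {l m n l' m' n'} (f : Term R l m) (g : Term R m n)
      (f' : Term R l' m') (g' : Term R m' n') :
      Rel q ((f.tensor f').comp (g.tensor g')) ((f.comp g).tensor (f'.comp g'))
  | tensor_assoc {m n m' n' m'' n''} (f : Term R m n) (g : Term R m' n') (h : Term R m'' n'') :
      Rel q (((f.tensor g).tensor h).comp (Term.eqTo (Nat.add_assoc n n' n'')))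
        ((Term.eqTo (Nat.add_assoc m m' m'')).comp (f.tensor (g.tensor h)))
  | unit_tensor {m n} (f : Term R m n) :
      Rel q (((Term.id 0).tensor f).comp (Term.eqTo (Nat.zero_add n)))
        ((Term.eqTo (Nat.zero_add m)).comp f)
  | tensor_unit {m n} (f : Term R m n) :
      Rel q ((f.tensor (Term.id 0)).comp (Term.eqTo (Nat.add_zero n)))
        ((Term.eqTo (Nat.add_zero m)).comp f)
  -- the relations between the generators; the domain `1` is written `0 + 1` or `1 + 0`, and
  -- `2 + 1`, `1 + 2` are both (definitionally) `3`
  | zigzag_left :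
      Rel q (((Term.cup.tensor (Term.id 1) : Term R (0 + 1) (2 + 1))).comp
        ((Term.id 1).tensor Term.cap : Term R (1 + 2) (1 + 0))) ((Term.id 1).smul q)
  | zigzag_right :
      Rel q ((((Term.id 1).tensor Term.cup : Term R (1 + 0) (1 + 2))).comp
        (Term.cap.tensor (Term.id 1) : Term R (2 + 1) (0 + 1))) ((Term.id 1).smul q)
  | circle : Rel q (Term.cup.comp Term.cap) ((Term.id 0).smul (q ^ 2 + 1))

theorem Rel.eqTo_comp {R : Type u} [CommRing R] (q : R) {l m n : ℕ} (h : l = m) (h' : m = n) :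
    Rel q ((Term.eqTo h : Term R l m).comp (Term.eqTo h')) (Term.eqTo (h.trans h')) := by
  subst h; subst h'; exact Rel.id_comp _

theorem Rel.eqTo_tensor {R : Type u} [CommRing R] (q : R) {m n m' n' : ℕ} (h : m = n)
    (h' : m' = n') :
    Rel q ((Term.eqTo h : Term R m n).tensor (Term.eqTo h'))
      (Term.eqTo (congrArg₂ (· + ·) h h')) := by
  subst h; subst h'; exact Rel.id_tensor_id _ _

/-- Equality of morphisms `[m] ⟶ [n]`. -/
def homSetoid {R : Type u} [CommRing R] (q : R) (m n : ℕ) : Setoid (Term R m n) where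
  r := Rel q
  iseqv := ⟨Rel.refl, Rel.symm, Rel.trans⟩

/-- The module of morphisms `[m] ⟶ [n]`. -/
def Hom {R : Type u} [CommRing R] (q : R) (m n : ℕ) : Type u := Quotient (homSetoid q m n)

namespace Hom

variable {R : Type u} [CommRing R] {q : R}

/-- The morphism denoted by a formal expression. -/
def mk (q : R) {m n : ℕ} (f : Term R m n) : Hom q m n := Quotient.mk (homSetoid q m n) f

theorem sound {m n : ℕ} {f g : Term R m n} (h : Rel q f g) : mk q f = mk q g :=
  Quotient.sound (s := homSetoid q m n) h

theorem exists_mk {m n : ℕ} (f : Hom q m n) : ∃ t, mk q t = f :=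
  Quotient.exists_rep f

/-- Composition, in diagrammatic order. -/
def comp {l m n : ℕ} (f : Hom q l m) (g : Hom q m n) : Hom q l n :=
  Quotient.map₂ (sa := homSetoid q l m) (sb := homSetoid q m n) (sc := homSetoid q l n)
    Term.comp (fun _ _ h _ _ h' => Rel.comp_congr h h') f g

/-- Tensor product of morphisms. -/
def tensor {m n m' n' : ℕ} (f : Hom q m n) (g : Hom q m' n') : Hom q (m + m') (n + n') :=
  Quotient.map₂ (sa := homSetoid q m n) (sb := homSetoid q m' n')
    (sc := homSetoid q (m + m') (n + n'))
    Term.tensor (fun _ _ h _ _ h' => Rel.tensor_congr h h') f g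

instance (m n : ℕ) : Zero (Hom q m n) := ⟨mk q Term.zero⟩

instance (m n : ℕ) : Add (Hom q m n) :=
  ⟨Quotient.map₂ (sa := homSetoid q m n) (sb := homSetoid q m n) (sc := homSetoid q m n)
    Term.add (fun _ _ h _ _ h' => Rel.add_congr h h')⟩

instance (m n : ℕ) : SMul R (Hom q m n) :=
  ⟨fun r => Quotient.map (sa := homSetoid q m n) (sb := homSetoid q m n)
    (Term.smul r) (fun _ _ h => Rel.smul_congr r h)⟩

instance (m n : ℕ) : Neg (Hom q m n) := ⟨fun f => (-1 : R) • f⟩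

theorem zero_add' {m n : ℕ} (f : Hom q m n) :
    0 + f = f := by
  obtain ⟨f, rfl⟩ := exists_mk f
  exact sound (Rel.zero_add f)

theorem add_comm' {m n : ℕ} (f g : Hom q m n) :
    f + g = g + f := by
  obtain ⟨f, rfl⟩ := exists_mk f
  obtain ⟨g, rfl⟩ := exists_mk g
  exact sound (Rel.add_comm f g)

theorem add_assoc' {m n : ℕ} (f g h : Hom q m n) :
    f + g + h = f + (g + h) := by
  obtain ⟨f, rfl⟩ := exists_mk f
  obtain ⟨g, rfl⟩ := exists_mk g
  obtain ⟨h, rfl⟩ := exists_mk h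
  exact sound (Rel.add_assoc f g h)

theorem smul_add' {m n : ℕ} (r : R) (f g : Hom q m n) :
    r • (f + g) = r • f + r • g := by
  obtain ⟨f, rfl⟩ := exists_mk f
  obtain ⟨g, rfl⟩ := exists_mk g
  exact sound (Rel.smul_add r f g)

theorem add_smul' {m n : ℕ} (r s : R) (f : Hom q m n) :
    (r + s) • f = r • f + s • f := by
  obtain ⟨f, rfl⟩ := exists_mk f
  exact sound (Rel.add_smul r s f)

theorem mul_smul' {m n : ℕ} (r s : R) (f : Hom q m n) :
    (r * s) • f = r • s • f := by
  obtain ⟨f, rfl⟩ := exists_mk f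
  exact sound (Rel.mul_smul r s f)

theorem one_smul' {m n : ℕ} (f : Hom q m n) :
    (1 : R) • f = f := by
  obtain ⟨f, rfl⟩ := exists_mk f
  exact sound (Rel.one_smul f)

theorem zero_smul' {m n : ℕ} (f : Hom q m n) :
    (0 : R) • f = 0 := by
  obtain ⟨f, rfl⟩ := exists_mk f
  exact sound (Rel.zero_smul f)

instance (m n : ℕ) : AddCommGroup (Hom q m n) where
  add_assoc := add_assoc'
  zero_add := zero_add'
  add_zero f := (add_comm' f 0).trans (zero_add' f)
  add_comm := add_comm'
  neg_add_cancel f := by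
    change (-1 : R) • f + f = 0
    conv_lhs => rw [← one_smul' f]
    rw [← mul_smul', ← add_smul', mul_one, neg_add_cancel, zero_smul']
  nsmul := nsmulRec
  zsmul := zsmulRec

instance (m n : ℕ) : Module R (Hom q m n) where
  one_smul := one_smul'
  mul_smul := mul_smul'
  add_smul := add_smul'
  zero_smul := fun f => zero_smul' f
  smul_add := smul_add'
  smul_zero r := by
    have h := mul_smul' r 0 (0 : Hom q m n)
    rw [mul_zero, zero_smul'] at h
    exact h.symm

theorem id_comp {m n : ℕ} (f : Hom q m n) :
    comp (mk q (Term.id m)) f = f := by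
  obtain ⟨f, rfl⟩ := exists_mk f
  exact sound (Rel.id_comp f)

theorem comp_id {m n : ℕ} (f : Hom q m n) :
    comp f (mk q (Term.id n)) = f := by
  obtain ⟨f, rfl⟩ := exists_mk f
  exact sound (Rel.comp_id f)

theorem assoc {k l m n : ℕ} (f : Hom q k l) (g : Hom q l m) (h : Hom q m n) :
    comp (comp f g) h = comp f (comp g h) := by
  obtain ⟨f, rfl⟩ := exists_mk f
  obtain ⟨g, rfl⟩ := exists_mk g
  obtain ⟨h, rfl⟩ := exists_mk h
  exact sound (Rel.assoc f g h)

theorem add_comp {l m n : ℕ} (f f' : Hom q l m) (g : Hom q m n) :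
    comp (f + f') g = comp f g + comp f' g := by
  obtain ⟨f, rfl⟩ := exists_mk f
  obtain ⟨f', rfl⟩ := exists_mk f'
  obtain ⟨g, rfl⟩ := exists_mk g
  exact sound (Rel.add_comp f f' g)

theorem comp_add {l m n : ℕ} (f : Hom q l m) (g g' : Hom q m n) :
    comp f (g + g') = comp f g + comp f g' := by
  obtain ⟨f, rfl⟩ := exists_mk f
  obtain ⟨g, rfl⟩ := exists_mk g
  obtain ⟨g', rfl⟩ := exists_mk g'
  exact sound (Rel.comp_add f g g')

theorem smul_comp {l m n : ℕ} (r : R) (f : Hom q l m) (g : Hom q m n) :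
    comp (r • f) g = r • comp f g := by
  obtain ⟨f, rfl⟩ := exists_mk f
  obtain ⟨g, rfl⟩ := exists_mk g
  exact sound (Rel.smul_comp r f g)

theorem comp_smul {l m n : ℕ} (r : R) (f : Hom q l m) (g : Hom q m n) :
    comp f (r • g) = r • comp f g := by
  obtain ⟨f, rfl⟩ := exists_mk f
  obtain ⟨g, rfl⟩ := exists_mk g
  exact sound (Rel.comp_smul r f g)

theorem add_tensor {m n m' n' : ℕ} (f f' : Hom q m n) (g : Hom q m' n') :
    tensor (f + f') g = tensor f g + tensor f' g := by
  obtain ⟨f, rfl⟩ := exists_mk f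
  obtain ⟨f', rfl⟩ := exists_mk f'
  obtain ⟨g, rfl⟩ := exists_mk g
  exact sound (Rel.add_tensor f f' g)

theorem tensor_add {m n m' n' : ℕ} (f : Hom q m n) (g g' : Hom q m' n') :
    tensor f (g + g') = tensor f g + tensor f g' := by
  obtain ⟨f, rfl⟩ := exists_mk f
  obtain ⟨g, rfl⟩ := exists_mk g
  obtain ⟨g', rfl⟩ := exists_mk g'
  exact sound (Rel.tensor_add f g g')

theorem smul_tensor {m n m' n' : ℕ} (r : R) (f : Hom q m n) (g : Hom q m' n') :
    tensor (r • f) g = r • tensor f g := by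
  obtain ⟨f, rfl⟩ := exists_mk f
  obtain ⟨g, rfl⟩ := exists_mk g
  exact sound (Rel.smul_tensor r f g)

theorem tensor_smul {m n m' n' : ℕ} (r : R) (f : Hom q m n) (g : Hom q m' n') :
    tensor f (r • g) = r • tensor f g := by
  obtain ⟨f, rfl⟩ := exists_mk f
  obtain ⟨g, rfl⟩ := exists_mk g
  exact sound (Rel.tensor_smul r f g)

theorem zero_tensor {m n m' n' : ℕ} (g : Hom q m' n') :
    tensor (0 : Hom q m n) g = 0 := by
  rw [← zero_smul R (0 : Hom q m n), smul_tensor, zero_smul]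

theorem tensor_zero {m n m' n' : ℕ} (f : Hom q m n) :
    tensor f (0 : Hom q m' n') = 0 := by
  rw [← zero_smul R (0 : Hom q m' n'), tensor_smul, zero_smul]

theorem tensor_comp_tensor {l m n l' m' n' : ℕ} (f : Hom q l m) (f' : Hom q l' m')
    (g : Hom q m n) (g' : Hom q m' n') :
    comp (tensor f f') (tensor g g') = tensor (comp f g) (comp f' g') := by
  obtain ⟨f, rfl⟩ := exists_mk f
  obtain ⟨f', rfl⟩ := exists_mk f'
  obtain ⟨g, rfl⟩ := exists_mk g
  obtain ⟨g', rfl⟩ := exists_mk g'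
  exact sound (Rel.tensor_comp_tensor f g f' g')

theorem tensor_assoc {m n m' n' m'' n'' : ℕ} (f : Hom q m n) (g : Hom q m' n')
    (h : Hom q m'' n'') :
    comp (tensor (tensor f g) h) (mk q (Term.eqTo (Nat.add_assoc n n' n''))) =
      comp (mk q (Term.eqTo (Nat.add_assoc m m' m''))) (tensor f (tensor g h)) := by
  obtain ⟨f, rfl⟩ := exists_mk f
  obtain ⟨g, rfl⟩ := exists_mk g
  obtain ⟨h, rfl⟩ := exists_mk h
  exact sound (Rel.tensor_assoc f g h)

theorem unit_tensor {m n : ℕ} (f : Hom q m n) :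
    comp (tensor (mk q (Term.id 0)) f) (mk q (Term.eqTo (Nat.zero_add n))) =
      comp (mk q (Term.eqTo (Nat.zero_add m))) f := by
  obtain ⟨f, rfl⟩ := exists_mk f
  exact sound (Rel.unit_tensor f)

theorem tensor_unit {m n : ℕ} (f : Hom q m n) :
    comp (tensor f (mk q (Term.id 0))) (mk q (Term.eqTo (Nat.add_zero n))) =
      comp (mk q (Term.eqTo (Nat.add_zero m))) f := by
  obtain ⟨f, rfl⟩ := exists_mk f
  exact sound (Rel.tensor_unit f)

end Hom

end TemperleyLieb

open TemperleyLieb in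
/-- The renormalized Temperley-Lieb category over a commutative ring `R` with parameter `q : R`:
the strict `R`-linear monoidal category with objects `[0], [1], [2], …` and
`[m] ⊗ [n] = [m + n]`, whose morphisms are generated by `cup : [0] ⟶ [2]` and `cap : [2] ⟶ [0]`
subject to: both zig-zags are `q • id`, and the circle is `(q ^ 2 + 1) • id`. -/
structure TLBar (R : Type u) [CommRing R] (q : R) : Type where
  /-- The object `[n]`. -/
  obj ::
  /-- The number `n` of the object `[n]`. -/
  strands : ℕ

namespace TLBar

open TemperleyLieb

variable {R : Type u} [CommRing R] {q : R}

instance : Category.{u} (TLBar R q) where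
  Hom X Y := Hom q X.strands Y.strands
  id X := Hom.mk q (Term.id X.strands)
  comp f g := Hom.comp f g
  id_comp := Hom.id_comp
  comp_id := Hom.comp_id
  assoc := Hom.assoc

instance (X Y : TLBar R q) : AddCommGroup (X ⟶ Y) :=
  inferInstanceAs (AddCommGroup (Hom q X.strands Y.strands))

instance (X Y : TLBar R q) : Module R (X ⟶ Y) :=
  inferInstanceAs (Module R (Hom q X.strands Y.strands))

instance : Preadditive (TLBar R q) where
  add_comp _ _ _ := Hom.add_comp
  comp_add _ _ _ := Hom.comp_add

instance : Linear R (TLBar R q) where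
  smul_comp _ _ _ := Hom.smul_comp
  comp_smul _ _ _ f r g := Hom.comp_smul r f g

/-- The identity of `[m] = [n]`, as an isomorphism. -/
def eqToIso {m n : ℕ} (h : m = n) : (obj m : TLBar R q) ≅ obj n where
  hom := Hom.mk q (Term.eqTo h)
  inv := Hom.mk q (Term.eqTo h.symm)
  hom_inv_id := Hom.sound (Rel.eqTo_comp q h h.symm)
  inv_hom_id := Hom.sound (Rel.eqTo_comp q h.symm h)

instance : MonoidalCategoryStruct (TLBar R q) where
  tensorObj X Y := obj (X.strands + Y.strands)
  tensorUnit := obj 0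
  tensorHom f g := Hom.tensor f g
  whiskerLeft X _ _ f := Hom.tensor (Hom.mk q (Term.id X.strands)) f
  whiskerRight f Y := Hom.tensor f (Hom.mk q (Term.id Y.strands))
  associator X Y Z := eqToIso (Nat.add_assoc X.strands Y.strands Z.strands)
  leftUnitor X := eqToIso (Nat.zero_add X.strands)
  rightUnitor X := eqToIso (Nat.add_zero X.strands)

instance : MonoidalCategory (TLBar R q) :=
  MonoidalCategory.ofTensorHom
    (id_tensorHom_id := fun X Y => Hom.sound (Rel.id_tensor_id X.strands Y.strands))
    (id_tensorHom := fun _ _ _ _ => rfl)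
    (tensorHom_id := fun _ _ => rfl)
    (tensorHom_comp_tensorHom := Hom.tensor_comp_tensor)
    (associator_naturality := Hom.tensor_assoc)
    (leftUnitor_naturality := Hom.unit_tensor)
    (rightUnitor_naturality := Hom.tensor_unit)
    (pentagon := fun _ _ _ _ => Hom.sound
      (((Rel.comp_congr (Rel.eqTo_tensor q _ _) ((Rel.comp_congr (Rel.refl _)
        (Rel.eqTo_tensor q _ _)).trans (Rel.eqTo_comp q _ _))).trans (Rel.eqTo_comp q _ _)).trans
        (Rel.eqTo_comp q _ _).symm))
    (triangle := fun _ _ => Hom.sound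
      (((Rel.comp_congr (Rel.refl _) (Rel.eqTo_tensor q _ _)).trans (Rel.eqTo_comp q _ _)).trans
        (Rel.eqTo_tensor q _ _).symm))

instance : MonoidalPreadditive (TLBar R q) where
  whiskerLeft_zero := Hom.tensor_zero _
  zero_whiskerRight := Hom.zero_tensor _
  whiskerLeft_add := Hom.tensor_add _
  add_whiskerRight f g := Hom.add_tensor f g _

instance : MonoidalLinear R (TLBar R q) where
  whiskerLeft_smul _ _ _ r f := Hom.tensor_smul r _ f
  smul_whiskerRight r _ _ f _ := Hom.smul_tensor r f _

end TLBar

/-- The crystal Temperley-Lieb category: the renormalized Temperley-Lieb category over `𝕜`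
at `q = 0`, so that both zig-zags are `0` and the circle is `id`. -/
abbrev TL₀ (𝕜 : Type u) [Field 𝕜] : Type := TLBar 𝕜 (0 : 𝕜)

/-! At `q = 0` the category acts on words in two brackets: `[n]` goes to the free module on words of
length `n`, `cup` creates the word `()`, and `cap` sends `()` to the empty word and every other word
of length two to zero. The circle is then the identity. Both zig-zags vanish, since next to a fresh
`()` the cap meets a pair starting with `)` or a pair ending with `(`. This is `Rel.eval_word_eq`.

The action preserves a finer invariant than length. Let `(` act on `ℕ` as the predecessor and `)` as
the successor; since `()` acts as the identity, every morphism preserves the span of the words with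
a given action (`Term.eval_mem_weightSpace`).

Suppose `[k]` were a right dual of `[1]`. The unit sends the empty word to a combination of words of
length `k + 1` acting as the identity, and each of these ends in `)` (`exists_eq_mul_of_true`). In
the triangle identity applied to `(`, the counit consumes everything but this last letter, so the
result is a multiple of `)`, while it should be `(`. -/

namespace TemperleyLieb

/-! ### Words and tensor products of linear maps. -/

section WordRepresentation

variable {R : Type u} [CommRing R]

/-- Words in two letters, `false` (an opening bracket) and `true` (a closing bracket). The words of
length `n` index a basis of the `n`-th tensor power of a free module of rank two. -/
abbrev Word : Type := FreeMonoid Bool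

/-- The sum of all tensor powers of a free module of rank two. -/
abbrev WordAlgebra (R : Type u) [CommRing R] : Type u := MonoidAlgebra R Word

/-- A word as a basis vector of the word algebra. -/
noncomputable def word (R : Type u) [CommRing R] : Word →* WordAlgebra R :=
  MonoidAlgebra.of R Word

/-- The word consisting of one pair of matching brackets. -/
def bracketPair : Word := FreeMonoid.of false * FreeMonoid.of true

/-- The linear extension of a map defined on words. -/
noncomputable def linExt (φ : Word → WordAlgebra R) : WordAlgebra R →ₗ[R] WordAlgebra R :=
  Finsupp.linearCombination R φ ∘ₗ (MonoidAlgebra.coeffLinearEquiv R).toLinearMap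

@[simp]
theorem linExt_word (φ : Word → WordAlgebra R) (w : Word) : linExt φ (word R w) = φ w := by
  simp [linExt, word]

/-- The tensor product of two linear maps, the first of which acts on the first `m` letters. -/
noncomputable def tensorMap (m : ℕ) (f g : WordAlgebra R →ₗ[R] WordAlgebra R) :
    WordAlgebra R →ₗ[R] WordAlgebra R :=
  linExt fun w => f (word R (FreeMonoid.ofList (w.toList.take m))) *
    g (word R (FreeMonoid.ofList (w.toList.drop m)))

/-- The length condition makes the cut after `m` letters fall exactly between `u` and `v`. -/
theorem tensorMap_word {m : ℕ} {u : Word} (hu : u.length = m) (v : Word)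
    (f g : WordAlgebra R →ₗ[R] WordAlgebra R) :
    tensorMap m f g (word R u * word R v) = f (word R u) * g (word R v) := by
  subst hu
  rw [← map_mul, tensorMap, linExt_word]
  congr 3
  · exact congrArg FreeMonoid.ofList (List.take_left (l₁ := u.toList) (l₂ := v.toList))
  · exact congrArg FreeMonoid.ofList (List.drop_left (l₁ := u.toList) (l₂ := v.toList))

theorem exists_eq_mul_of_length_eq_add {m n : ℕ} {w : Word} (hw : w.length = m + n) :
    ∃ u v : Word, w = u * v ∧ u.length = m ∧ v.length = n := by
  have hw' : w.toList.length = m + n := hw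
  refine ⟨FreeMonoid.ofList (w.toList.take m), FreeMonoid.ofList (w.toList.drop m),
    (List.take_append_drop m w.toList).symm, ?_, ?_⟩
  · change (w.toList.take m).length = m
    simp [hw']
  · change (w.toList.drop m).length = n
    simp [hw']

/-! ### Weights of words. -/

/-- The action of words on `ℕ` in which an opening bracket acts as the predecessor and a closing
bracket as the successor. A balanced word acts as the identity. -/
def bracketAction : Word →* Function.End ℕ :=
  FreeMonoid.lift fun b => if b then Nat.succ else Nat.pred

theorem bracketAction_bracketPair : bracketAction bracketPair = 1 := by
  rw [bracketPair, map_mul]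
  rfl

/-- The span of the words of length `n` which act on `ℕ` as `p`. -/
noncomputable def weightSpace (R : Type u) [CommRing R] (n : ℕ) (p : Function.End ℕ) :
    Submodule R (WordAlgebra R) :=
  Submodule.span R (word R '' {w | w.length = n ∧ bracketAction w = p})

theorem word_mem_weightSpace {w : Word} {n : ℕ} {p : Function.End ℕ} (hn : w.length = n)
    (hp : bracketAction w = p) : word R w ∈ weightSpace R n p :=
  Submodule.subset_span ⟨w, ⟨hn, hp⟩, rfl⟩

theorem one_mem_weightSpace : (1 : WordAlgebra R) ∈ weightSpace R 0 1 := by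
  rw [← map_one (word R)]
  exact word_mem_weightSpace rfl (map_one _)

theorem mul_mem_weightSpace {m n : ℕ} {p q : Function.End ℕ} {a b : WordAlgebra R}
    (ha : a ∈ weightSpace R m p) (hb : b ∈ weightSpace R n q) :
    a * b ∈ weightSpace R (m + n) (p * q) := by
  have h := Submodule.mul_mem_mul ha hb
  rw [weightSpace, weightSpace, Submodule.span_mul_span] at h
  refine Submodule.span_mono ?_ h
  rintro _ ⟨_, ⟨u, ⟨hu, hu'⟩, rfl⟩, _, ⟨v, ⟨hv, hv'⟩, rfl⟩, rfl⟩
  exact ⟨u * v, ⟨by rw [FreeMonoid.length_mul, hu, hv], by rw [map_mul, hu', hv']⟩, map_mul _ _ _⟩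

theorem linearMap_eq_of_eq_on_words {M : Type*} [AddCommGroup M] [Module R M] {n : ℕ}
    {f g : WordAlgebra R →ₗ[R] M} (h : ∀ w : Word, w.length = n → f (word R w) = g (word R w))
    {p : Function.End ℕ} {a : WordAlgebra R} (ha : a ∈ weightSpace R n p) : f a = g a := by
  refine LinearMap.eqOn_span ?_ ha
  rintro _ ⟨w, ⟨hw, -⟩, rfl⟩
  exact h w hw

theorem linearMap_mem_of_mem_on_words {n : ℕ} {S : Submodule R (WordAlgebra R)}
    {p : Function.End ℕ} {f : WordAlgebra R →ₗ[R] WordAlgebra R}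
    (h : ∀ w : Word, w.length = n → bracketAction w = p → f (word R w) ∈ S)
    {a : WordAlgebra R} (ha : a ∈ weightSpace R n p) : f a ∈ S := by
  have : weightSpace R n p ≤ S.comap f := by
    refine Submodule.span_le.2 ?_
    rintro _ ⟨w, ⟨hw, hw'⟩, rfl⟩
    exact h w hw hw'
  exact this ha

/-- Extends `tensorMap_word` bilinearly, one factor at a time; the interchange law needs it because
the images of words are only linear combinations. -/
theorem tensorMap_mul {m n : ℕ} {p q : Function.End ℕ} (f g : WordAlgebra R →ₗ[R] WordAlgebra R)
    {a b : WordAlgebra R} (ha : a ∈ weightSpace R m p) (hb : b ∈ weightSpace R n q) :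
    tensorMap m f g (a * b) = f a * g b := by
  have h₁ (u : Word) (hu : u.length = m) : tensorMap m f g (word R u * b) = f (word R u) * g b :=
    linearMap_eq_of_eq_on_words (f := tensorMap m f g ∘ₗ LinearMap.mulLeft R (word R u))
      (g := LinearMap.mulLeft R (f (word R u)) ∘ₗ g) (fun v _ => tensorMap_word hu v f g) hb
  exact linearMap_eq_of_eq_on_words (f := tensorMap m f g ∘ₗ LinearMap.mulRight R b)
    (g := LinearMap.mulRight R (g b) ∘ₗ f) h₁ ha

/-! ### The representation on words: invariance of weights and the defining relations. -/

open Classical in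
/-- The linear map represented by a formal expression: `cup` inserts a pair of matching brackets,
and `cap` removes such a pair and kills the other words of length two. Only the restriction to the
words whose length is the domain of the expression is meaningful. -/
noncomputable def Term.eval : {m n : ℕ} → Term R m n → (WordAlgebra R →ₗ[R] WordAlgebra R)
  | _, _, .eqTo _ => LinearMap.id
  | _, _, .cup => linExt fun _ => word R bracketPair
  | _, _, .cap => linExt fun w => if w = bracketPair then 1 else 0
  | _, _, .comp f g => g.eval ∘ₗ f.eval
  | _, _, .tensor (m := m) f g => tensorMap m f.eval g.eval
  | _, _, .zero => 0
  | _, _, .add f g => f.eval + g.eval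
  | _, _, .smul r f => r • f.eval

/-- Only the generators need checking: `cup` and `cap` trade the empty word for `()`, and both act
trivially. Tensor products are covered because the action is multiplicative in the word. -/
theorem Term.eval_mem_weightSpace {m n : ℕ} (f : Term R m n) {p : Function.End ℕ}
    {a : WordAlgebra R} (ha : a ∈ weightSpace R m p) : f.eval a ∈ weightSpace R n p := by
  induction f generalizing p a with
  | eqTo h => subst h; exact ha
  | cup =>
    refine linearMap_mem_of_mem_on_words (fun w hw hp => ?_) ha
    obtain rfl := FreeMonoid.length_eq_zero.1 hw
    rw [eval, linExt_word]
    exact word_mem_weightSpace rfl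
      (bracketAction_bracketPair.trans ((map_one bracketAction).symm.trans hp))
  | cap =>
    refine linearMap_mem_of_mem_on_words (fun w hw hp => ?_) ha
    rw [eval, linExt_word]
    split_ifs with h
    · rw [← hp, h, bracketAction_bracketPair]
      exact one_mem_weightSpace
    · exact zero_mem _
  | comp f g hf hg => exact hg (hf ha)
  | tensor f g hf hg =>
    refine linearMap_mem_of_mem_on_words (fun w hw hp => ?_) ha
    obtain ⟨u, v, rfl, hu, hv⟩ := exists_eq_mul_of_length_eq_add hw
    rw [eval, map_mul, tensorMap_word hu, ← hp, map_mul]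
    exact mul_mem_weightSpace (hf (word_mem_weightSpace hu rfl)) (hg (word_mem_weightSpace hv rfl))
  | zero => exact zero_mem _
  | add f g hf hg => exact add_mem (hf ha) (hg ha)
  | smul r f hf => exact Submodule.smul_mem _ r (hf ha)

theorem Term.eval_word_mem {m n : ℕ} (f : Term R m n) {w : Word} (hw : w.length = m) :
    f.eval (word R w) ∈ weightSpace R n (bracketAction w) :=
  f.eval_mem_weightSpace (word_mem_weightSpace hw rfl)

/-- The restriction on length is essential: off the words of the source length, evaluation carries
no meaning and need not respect the relations. -/
theorem Rel.eval_word_eq {m n : ℕ} {f g : Term R m n} (h : Rel (0 : R) f g) (w : Word)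
    (hw : w.length = m) : f.eval (word R w) = g.eval (word R w) := by
  induction h generalizing w with
  | refl f => rfl
  | symm _ ih => exact (ih w hw).symm
  | trans _ _ ih₁ ih₂ => exact (ih₁ w hw).trans (ih₂ w hw)
  | @comp_congr _ _ _ f f' g g' _ _ ih₁ ih₂ =>
    simp only [Term.eval, LinearMap.comp_apply, ih₁ w hw]
    -- The image of `w` is homogeneous of the intermediate length, so agreement on words of that
    -- length suffices.
    exact linearMap_eq_of_eq_on_words ih₂ (f'.eval_word_mem hw)
  | tensor_congr _ _ ih₁ ih₂ =>
    obtain ⟨u, v, rfl, hu, hv⟩ := exists_eq_mul_of_length_eq_add hw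
    simp only [Term.eval, map_mul, tensorMap_word hu, ih₁ u hu, ih₂ v hv]
  | add_congr _ _ ih₁ ih₂ => simp only [Term.eval, LinearMap.add_apply, ih₁ w hw, ih₂ w hw]
  | smul_congr r _ ih => simp only [Term.eval, LinearMap.smul_apply, ih w hw]
  | id_comp f => rfl
  | comp_id f => rfl
  | assoc f g h => rfl
  | add_assoc f g h => simp only [Term.eval, _root_.add_assoc]
  | add_comm f g => simp only [Term.eval, _root_.add_comm]
  | zero_add f => simp only [Term.eval, _root_.zero_add]
  | smul_add r f g => simp only [Term.eval, _root_.smul_add]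
  | add_smul r s f => simp only [Term.eval, _root_.add_smul]
  | mul_smul r s f => simp only [Term.eval, SemigroupAction.mul_smul]
  | one_smul f => simp only [Term.eval, _root_.one_smul]
  | zero_smul f => simp only [Term.eval, _root_.zero_smul]
  | add_comp f f' g => simp only [Term.eval, LinearMap.comp_add]
  | comp_add f g g' => simp only [Term.eval, LinearMap.add_comp]
  | smul_comp r f g => simp only [Term.eval, LinearMap.comp_smul]
  | comp_smul r f g => simp only [Term.eval, LinearMap.smul_comp]
  | add_tensor f f' g =>
    obtain ⟨u, v, rfl, hu, -⟩ := exists_eq_mul_of_length_eq_add hw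
    simp only [Term.eval, map_mul, tensorMap_word hu, LinearMap.add_apply, add_mul]
  | tensor_add f g g' =>
    obtain ⟨u, v, rfl, hu, -⟩ := exists_eq_mul_of_length_eq_add hw
    simp only [Term.eval, map_mul, tensorMap_word hu, LinearMap.add_apply, mul_add]
  | smul_tensor r f g =>
    obtain ⟨u, v, rfl, hu, -⟩ := exists_eq_mul_of_length_eq_add hw
    simp only [Term.eval, map_mul, tensorMap_word hu, LinearMap.smul_apply, smul_mul_assoc]
  | tensor_smul r f g =>
    obtain ⟨u, v, rfl, hu, -⟩ := exists_eq_mul_of_length_eq_add hw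
    simp only [Term.eval, map_mul, tensorMap_word hu, LinearMap.smul_apply, mul_smul_comm]
  | id_tensor_id m n =>
    obtain ⟨u, v, rfl, hu, -⟩ := exists_eq_mul_of_length_eq_add hw
    simp only [Term.eval, map_mul, tensorMap_word hu, LinearMap.id_apply]
  | tensor_comp_tensor f g f' g' =>
    obtain ⟨u, v, rfl, hu, hv⟩ := exists_eq_mul_of_length_eq_add hw
    simp only [Term.eval, map_mul, tensorMap_word hu, LinearMap.comp_apply]
    exact tensorMap_mul _ _ (f.eval_word_mem hu) (f'.eval_word_mem hv)
  | tensor_assoc f g h =>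
    obtain ⟨w', v, rfl, hw', -⟩ := exists_eq_mul_of_length_eq_add hw
    obtain ⟨t, u, rfl, ht, -⟩ := exists_eq_mul_of_length_eq_add hw'
    simp only [Term.eval, LinearMap.comp_apply, LinearMap.id_apply]
    rw [map_mul, tensorMap_word hw', map_mul, tensorMap_word ht, mul_assoc (word R t), ← map_mul,
      tensorMap_word ht, map_mul, tensorMap_word (by simp_all [FreeMonoid.length_mul]), mul_assoc]
  | unit_tensor f =>
    -- The unit object corresponds to the empty word, split off as a prefix.
    have h := tensorMap_word (R := R) FreeMonoid.length_one w LinearMap.id f.eval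
    rw [map_one, one_mul, LinearMap.id_apply, one_mul] at h
    exact h
  | tensor_unit f =>
    have h := tensorMap_word (R := R) hw 1 f.eval LinearMap.id
    rw [map_one, mul_one, LinearMap.id_apply, mul_one] at h
    exact h
  | zigzag_left =>
    obtain ⟨b, rfl⟩ := FreeMonoid.length_eq_one.1 hw
    have h := tensorMap_word (R := R) FreeMonoid.length_one (FreeMonoid.of b)
      (Term.cup : Term R 0 2).eval LinearMap.id
    rw [map_one, one_mul] at h
    have hne : FreeMonoid.of true * FreeMonoid.of b ≠ bracketPair := by
      change ([true, b] : List Bool) ≠ [false, true]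
      simp
    simp only [Term.eval, LinearMap.comp_apply, _root_.zero_smul] at h ⊢
    rw [h, ← map_one (word R), linExt_word, LinearMap.id_apply, ← map_mul,
      show bracketPair * FreeMonoid.of b = FreeMonoid.of false * (FreeMonoid.of true * FreeMonoid.of b)
      from mul_assoc _ _ _, map_mul, tensorMap_word (FreeMonoid.length_of _), linExt_word,
      if_neg hne, mul_zero, LinearMap.zero_apply]
  | zigzag_right =>
    obtain ⟨b, rfl⟩ := FreeMonoid.length_eq_one.1 hw
    have h := tensorMap_word (R := R) (FreeMonoid.length_of b) 1 LinearMap.id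
      (Term.cup : Term R 0 2).eval
    rw [map_one, mul_one] at h
    have hne : FreeMonoid.of b * FreeMonoid.of false ≠ bracketPair := by
      change ([b, false] : List Bool) ≠ [false, true]
      simp
    have hlen : (FreeMonoid.of b * FreeMonoid.of false).length = 2 := rfl
    simp only [Term.eval, LinearMap.comp_apply, _root_.zero_smul] at h ⊢
    rw [h, ← map_one (word R), linExt_word, LinearMap.id_apply, ← map_mul,
      show FreeMonoid.of b * bracketPair = FreeMonoid.of b * FreeMonoid.of false * FreeMonoid.of true
      from (mul_assoc _ _ _).symm, map_mul, tensorMap_word hlen, linExt_word, if_neg hne, zero_mul,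
      LinearMap.zero_apply]
  | circle =>
    obtain rfl := FreeMonoid.length_eq_zero.1 hw
    rw [Term.eval, LinearMap.comp_apply, Term.eval, Term.eval, linExt_word, linExt_word, if_pos rfl]
    simp [Term.eval]

/-- A nonempty word which acts as the identity ends with a closing bracket. -/
theorem exists_eq_mul_of_true {k : ℕ} {w : Word} (hw : w.length = k + 1)
    (hp : bracketAction w = 1) : ∃ u : Word, u.length = k ∧ w = u * FreeMonoid.of true := by
  obtain ⟨u, v, rfl, hu, hv⟩ := exists_eq_mul_of_length_eq_add hw
  obtain ⟨b, rfl⟩ := FreeMonoid.length_eq_one.1 hv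
  cases b
  -- A final `(` acts first, and the truncated predecessor identifies `0` and `1`; hence the word
  -- cannot act injectively.
  · have h₀ := congrFun hp 0
    have h₁ := congrFun hp 1
    rw [map_mul] at h₀ h₁
    exact absurd (h₀.symm.trans h₁) zero_ne_one
  · exact ⟨u, hu, rfl⟩

/-- The triangle identity for a right dual `[k]` of `[1]` fails for all candidates for the unit and
the counit. -/
theorem not_rel_triangle [Nontrivial R] {k : ℕ} (η : Term R 0 (k + 1)) (ε : Term R (1 + k) 0)
    (h₁ : 1 + 0 = 1) (h₂ : 1 + (k + 1) = 1 + k + 1) (h₃ : 1 = 0 + 1) :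
    ¬ Rel (0 : R) ((((Term.id 1).tensor η).comp ((Term.eqTo h₂).comp (ε.tensor (Term.id 1)))))
      ((Term.eqTo h₁).comp (Term.eqTo h₃)) := by
  intro h
  -- The test vector is `(`, the letter that the left side can never output.
  have key := h.eval_word_eq (FreeMonoid.of false) rfl
  have hη : ((Term.id 1).tensor η).eval (word R (FreeMonoid.of false)) =
      word R (FreeMonoid.of false) * η.eval 1 := by
    have := tensorMap_word (R := R) (FreeMonoid.length_of false) 1 LinearMap.id η.eval
    rw [map_one, mul_one, LinearMap.id_apply] at this
    exact this
  have hη' : η.eval 1 ∈ weightSpace R (k + 1) 1 := η.eval_mem_weightSpace one_mem_weightSpace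
  have hε : tensorMap (1 + k) ε.eval LinearMap.id (word R (FreeMonoid.of false) * η.eval 1) ∈
      Submodule.span R {word R (FreeMonoid.of true)} := by
    refine linearMap_mem_of_mem_on_words (f := tensorMap (1 + k) ε.eval LinearMap.id ∘ₗ
      LinearMap.mulLeft R (word R (FreeMonoid.of false))) (fun w hw hp => ?_) hη'
    obtain ⟨u, hu, rfl⟩ := exists_eq_mul_of_true hw hp
    have hu' : (FreeMonoid.of false * u).length = 1 + k := by
      rw [FreeMonoid.length_mul, FreeMonoid.length_of, hu]
    rw [LinearMap.comp_apply, LinearMap.mulLeft_apply, ← map_mul, ← mul_assoc, map_mul,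
      tensorMap_word hu', LinearMap.id_apply]
    -- The counit lands in length zero, so its value is a scalar multiple of the empty word and only
    -- the final `)` survives.
    refine linearMap_mem_of_mem_on_words
      (f := LinearMap.mulRight R (word R (FreeMonoid.of true))) (fun v hv _ => ?_)
      (ε.eval_word_mem hu')
    obtain rfl := FreeMonoid.length_eq_zero.1 hv
    simp [Submodule.mem_span_singleton_self]
  simp only [Term.eval, LinearMap.comp_apply, LinearMap.id_apply] at key hη
  rw [hη] at key
  rw [key, Submodule.mem_span_singleton] at hε
  obtain ⟨r, hr⟩ := hε
  have := congrArg (fun a => a.coeff (FreeMonoid.of false)) hr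
  have hne : FreeMonoid.of true ≠ FreeMonoid.of false :=
    FreeMonoid.of_injective.ne Bool.true_eq_false.mp
  simp [word, Finsupp.single_eq_of_ne hne.symm] at this

end WordRepresentation

end TemperleyLieb

/-! ### Absence of duals in the category. -/

open TemperleyLieb in
theorem TLBar.isEmpty_exactPairing_obj_one {R : Type u} [CommRing R] [Nontrivial R]
    (Y : TLBar R (0 : R)) : IsEmpty (ExactPairing Y (TLBar.obj 1 : TLBar R (0 : R))) := by
  refine ⟨fun e => ?_⟩
  obtain ⟨η, hη⟩ := Hom.exists_mk (q := (0 : R)) (m := 0) (n := Y.strands + 1) e.coevaluation'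
  obtain ⟨ε, hε⟩ := Hom.exists_mk (q := (0 : R)) (m := 1 + Y.strands) (n := 0) e.evaluation'
  have h := e.coevaluation_evaluation'
  rw [← hη, ← hε] at h
  -- Whiskerings, associator and unitors unfold to classes of formal expressions, so the triangle
  -- identity is a relation between representatives.
  exact not_rel_triangle η ε _ (Nat.add_assoc _ _ _).symm _ (Quotient.exact h)

theorem mainTheorem8 (𝕜 : Type u) [Field 𝕜] :
    (∀ Y : TL₀ 𝕜, IsEmpty (ExactPairing Y (TLBar.obj 1 : TL₀ 𝕜))) ∧
      IsEmpty (RigidCategory (TL₀ 𝕜)) := by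
  refine ⟨TLBar.isEmpty_exactPairing_obj_one, ⟨fun h => ?_⟩⟩
  -- Mathlib's left dual of `X` has its unit into `ᘁX ⊗ X`, so it is the right dual in the
  -- convention used here.
  have d : HasLeftDual (TLBar.obj 1 : TL₀ 𝕜) := h.toLeftRigidCategory.leftDual _
  exact (TLBar.isEmpty_exactPairing_obj_one d.leftDual).false d.exact
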